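/- Let $0 \le k \le n$ be integers. For $x \in \{0,1,2\}^n$ write $|x| = \sum_{i=1}^n x_i$. Call a subset $A \subseteq \{0,1,2\}^n$ admissible if there are no two distinct elements $x, y \in A$ such that $x_i \le y_i$ for all $1 \le i \le n$ and $x_i < y_i$ for at most $k$ coordinates $i$. Then the set $$B = \{x \in \{0,1,2\}^n : |x| \equiv n \pmod{2k+1}\}$$ is admissible, and every admissible set $A$ satisfies $|A| \le |B|$. Moreover, if $k \ne 1$, then $B$ is the unique largest admissible set: every admissible set $A$ with $|A| = |B|$ equals $B$. -/

import Mathlib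

/-- The coordinate sum `|x| = ∑ i, x i` (a natural number) of a point of `{0, 1, 2}^n`. -/
def coordSum {n : ℕ} (x : Fin n → Fin 3) : ℕ := ∑ i, (x i : ℕ)

/-- `A ⊆ {0, 1, 2}^n` contains no two distinct elements `x ≤ y` (coordinatewise) with
`x i < y i` for at most `k` coordinates `i`. -/
def Admissible {n : ℕ} (k : ℕ) (A : Finset (Fin n → Fin 3)) : Prop :=
  ¬ ∃ x ∈ A, ∃ y ∈ A, x ≠ y ∧ (∀ i, x i ≤ y i) ∧
    (Finset.univ.filter fun i : Fin n => x i < y i).card ≤ k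

/-- The set `{x ∈ {0, 1, 2}^n : |x| ≡ n (mod 2k + 1)}`. -/
def middleLayers (n k : ℕ) : Finset (Fin n → Fin 3) :=
  Finset.univ.filter fun x => coordSum x ≡ n [MOD 2 * k + 1]

/-!
Sending a monomial `x ^ a * y ^ b * z ^ c` to the proportion of words with `a` zeros, `b` ones and
`c` twos that lie in `A` extends to a linear functional on polynomials, whose value at
`(x + y + z) ^ n` is the cardinality of `A`. A chain of words that raises `j` coordinates one after
another from `0` to `2` corresponds to a monomial times a polynomial `C j` (`chainPoly`), and for
`j ≤ k` an admissible set meets such a chain at most once. The identity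
`(x + y + z) * C (j + 1) = C (j + 2) + y * C (j + 1) + x * z * C j`
expands `(x + y + z) ^ n` as a sum of chains that have `j = k`, or that have `j < k` and as many
coordinates fixed at `0` as at `2`. The set `B` meets each of these exactly once, so it is a largest
admissible set.

Any other largest set also meets them exactly once on average. For `2 ≤ k` this forces density one
on the types with `a = c`, hence density zero on the types with `0 < |a - c| ≤ 2 * k`, and then the
chains with `j = k` determine the remaining densities, working outwards from `a = c`.
-/

open Finset MvPolynomial
open scoped BigOperators

section PermDensity

variable {ι α : Type*} [Fintype ι]

theorem expect_eq_iff_of_le {M : Type*} [AddCommMonoid M] [PartialOrder M]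
    [IsOrderedCancelAddMonoid M] [Module ℚ≥0 M] [PosSMulStrictMono ℚ≥0 M] [Nonempty ι] {f : ι → M}
    {a : M} (h : ∀ i, f i ≤ a) : 𝔼 i, f i = a ↔ ∀ i, f i = a := by
  refine ⟨fun hf i => (h i).eq_of_not_lt fun hi => ?_, fun hf => ?_⟩
  · exact (expect_lt (fun i _ => h i) ⟨i, mem_univ i, hi⟩).ne hf
  · simp only [hf, Fintype.expect_const]

/-- The type of a word, as the exponent vector recording how often each letter occurs in it. -/
noncomputable def wordType (w : ι → α) : α →₀ ℕ := ∑ i, Finsupp.single (w i) 1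

theorem monomial_wordType (w : ι → α) :
    monomial (wordType w) (1 : ℚ) = ∏ i, X (w i) :=
  monomial_sum_one _ _

theorem wordType_apply [DecidableEq α] (w : ι → α) (a : α) : wordType w a = #{i | w i = a} := by
  simp [wordType, Finsupp.finsetSum_apply, Finsupp.single_apply]

theorem exists_perm_comp_eq_of_wordType_eq {v w : ι → α} (h : wordType v = wordType w) :
    ∃ σ : Equiv.Perm ι, w ∘ σ = v := by
  classical
  have fiberEquiv (a : α) : Nonempty ({i // v i = a} ≃ {i // w i = a}) :=
    Fintype.card_eq.1 <| by
      simpa only [Fintype.card_subtype, wordType_apply] using DFunLike.congr_fun h a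
  exact ⟨Equiv.ofFiberEquiv fun a => (fiberEquiv a).some, funext (Equiv.ofFiberEquiv_map _)⟩

variable [DecidableEq ι] [DecidableEq α]

/-- The linear functional on polynomials sending the commutative image `∏ i, X (w i)` of a word `w`
to the proportion of rearrangements of `w` that lie in `A`. Monomials that are not the image of a
word indexed by `ι` are sent to `0`. -/
noncomputable def permDensity (A : Finset (ι → α)) : MvPolynomial α ℚ →ₗ[ℚ] ℚ :=
  (basisMonomials α ℚ).constr ℚ <| Function.extend wordType
    (fun w : ι → α => 𝔼 σ : Equiv.Perm ι, if w ∘ σ ∈ A then (1 : ℚ) else 0) 0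

theorem permDensity_prod_X (A : Finset (ι → α)) (w : ι → α) :
    permDensity A (∏ i, X (w i)) =
      𝔼 σ : Equiv.Perm ι, if w ∘ σ ∈ A then (1 : ℚ) else 0 := by
  have hfactors : (fun w : ι → α => 𝔼 σ : Equiv.Perm ι,
      if w ∘ σ ∈ A then (1 : ℚ) else 0).FactorsThrough wordType := by
    intro v w h
    obtain ⟨τ, rfl⟩ := exists_perm_comp_eq_of_wordType_eq h
    exact Fintype.expect_equiv (Equiv.mulLeft τ) _ _ fun σ => rfl
  rw [← monomial_wordType, ← hfactors.extend_apply 0]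
  exact (basisMonomials α ℚ).constr_basis ℚ _ _

theorem permDensity_prod_X_nonneg (A : Finset (ι → α)) (w : ι → α) :
    0 ≤ permDensity A (∏ i, X (w i)) := by
  rw [permDensity_prod_X]
  exact expect_nonneg fun σ _ => by positivity

theorem permDensity_prod_X_eq_one_iff {A : Finset (ι → α)} {w : ι → α} :
    permDensity A (∏ i, X (w i)) = 1 ↔ ∀ σ : Equiv.Perm ι, w ∘ σ ∈ A := by
  rw [permDensity_prod_X, expect_eq_iff_of_le fun σ => by split_ifs <;> norm_num]
  simp

theorem sum_permDensity_prod_X {κ : Type*} (A : Finset (ι → α)) (s : Finset κ)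
    (W : κ → ι → α) :
    ∑ t ∈ s, permDensity A (∏ i, X (W t i)) =
      𝔼 σ : Equiv.Perm ι, (#{t ∈ s | W t ∘ σ ∈ A} : ℚ) := by
  simp only [permDensity_prod_X, ← expect_sum_comm, natCast_card_filter]

theorem permDensity_sum_X_pow [Fintype α] {n : ℕ} (A : Finset (Fin n → α)) :
    permDensity A ((∑ a, X a) ^ n) = #A := by
  have card_preimage (σ : Equiv.Perm (Fin n)) : #{w : Fin n → α | w ∘ σ ∈ A} = #A :=
    card_equiv (σ.symm.arrowCongr (Equiv.refl α)) fun w => by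
      simp only [mem_filter, mem_univ, true_and]
      rfl
  rw [Fintype.sum_pow, map_sum, sum_permDensity_prod_X]
  simp only [card_preimage, Fintype.expect_const]

end PermDensity

section ChainPoly

variable {R : Type*} [CommSemiring R] (x y z : R)

/-- The sum of the monomials met along a chain of words that raises `j` coordinates one after
another from `0` to `2`, where `x`, `y`, `z` stand for the letters `0`, `1`, `2`: after `s` steps,
`s / 2` coordinates have become `2` and `s % 2` coordinates are on their way. -/
def chainPoly (j : ℕ) : R :=
  ∑ s ∈ range (2 * j + 1), x ^ (j - (s + 1) / 2) * y ^ (s % 2) * z ^ (s / 2)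

theorem chainPoly_zero : chainPoly x y z 0 = 1 := by
  simp [chainPoly]

theorem chainPoly_succ (j : ℕ) :
    chainPoly x y z (j + 1) = (x + y) * x ^ j + z * chainPoly x y z j := by
  have shift (s : ℕ) : x ^ (j + 1 - (s + 1 + 1 + 1) / 2) * y ^ ((s + 1 + 1) % 2) *
      z ^ ((s + 1 + 1) / 2) = z * (x ^ (j - (s + 1) / 2) * y ^ (s % 2) * z ^ (s / 2)) := by
    rw [show j + 1 - (s + 1 + 1 + 1) / 2 = j - (s + 1) / 2 by omega,
      show (s + 1 + 1) % 2 = s % 2 by omega, show (s + 1 + 1) / 2 = s / 2 + 1 by omega]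
    ring
  rw [chainPoly, show 2 * (j + 1) + 1 = 2 * j + 1 + 1 + 1 by ring, sum_range_succ',
    sum_range_succ', sum_congr rfl fun s _ => shift s, ← mul_sum, ← chainPoly]
  simp only [zero_add, Nat.reduceAdd, Order.lt_two_iff, zero_le, Nat.div_self,
    add_tsub_cancel_right, Nat.mod_succ, pow_one, Nat.reduceDiv, pow_zero, mul_one, tsub_zero,
    Nat.zero_mod, Nat.zero_div]
  ring

/-- `(x + y + z) ^ r` times the `j`-th chain polynomial times the monomial of type `(a, b, c)`: the
sum over all chains raising `j` coordinates, with `a`, `b`, `c` further coordinates fixed at `0`,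
`1`, `2` and `r` coordinates fixed at arbitrary letters. -/
def chainTerm (r j a b c : ℕ) : R :=
  (x + y + z) ^ r * chainPoly x y z j * (x ^ a * y ^ b * z ^ c)

theorem chainTerm_succ (r j a b c : ℕ) :
    chainTerm x y z (r + 1) j a b c = chainTerm x y z r j (a + 1) b c +
      chainTerm x y z r j a (b + 1) c + chainTerm x y z r j a b (c + 1) := by
  unfold chainTerm
  ring

theorem chainTerm_succ_zero (r a b c : ℕ) :
    chainTerm x y z (r + 1) 0 a b c = chainTerm x y z r 1 a b c := by
  simp only [chainTerm, chainPoly_succ, chainPoly_zero]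
  ring

theorem chainTerm_succ_succ (r j a b c : ℕ) :
    chainTerm x y z (r + 1) (j + 1) a b c = chainTerm x y z r (j + 2) a b c +
      chainTerm x y z r (j + 1) a (b + 1) c + chainTerm x y z r j (a + 1) b (c + 1) := by
  simp only [chainTerm, chainPoly_succ]
  ring

theorem chainTerm_zero_zero (a b c : ℕ) : chainTerm x y z 0 0 a b c = x ^ a * y ^ b * z ^ c := by
  rw [chainTerm, chainPoly_zero, pow_zero, one_mul, one_mul]

variable {x y z} {M : Type*} [AddCommMonoid M] [PartialOrder M]

/-- The functional `D` is nonnegative on the chains in dimension `n` that raise `k` coordinates, and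
on the shorter chains with as many coordinates fixed at `0` as at `2`. -/
structure ChainNonneg (x y z : R) (n k : ℕ) (D : R →+ M) : Prop where
  full : ∀ a b c, k + a + b + c = n → 0 ≤ D (chainTerm x y z 0 k a b c)
  balanced : ∀ j a b, j < k → j + a + b + a = n → 0 ≤ D (chainTerm x y z 0 j a b a)

namespace ChainNonneg

variable [IsOrderedAddMonoid M] {n k r j a b c : ℕ} {D : R →+ M}

theorem chainTerm_full_nonneg (h : ChainNonneg x y z n k D) (hn : r + k + a + b + c = n) :
    0 ≤ D (chainTerm x y z r k a b c) := by
  induction r generalizing a b c with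
  | zero => exact h.full a b c (by omega)
  | succ r ih =>
    rw [chainTerm_succ, map_add, map_add]
    exact add_nonneg (add_nonneg (ih (by omega)) (ih (by omega))) (ih (by omega))

theorem chainTerm_balanced_nonneg (h : ChainNonneg x y z n k D) (hj : j ≤ k)
    (hn : r + j + a + b + a = n) : 0 ≤ D (chainTerm x y z r j a b a) := by
  induction r generalizing j a b with
  | zero =>
    rcases hj.eq_or_lt with rfl | hj
    exacts [h.full a b a (by omega), h.balanced j a b hj (by omega)]
  | succ r ih =>
    rcases hj.eq_or_lt with rfl | hj
    · exact h.chainTerm_full_nonneg hn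
    cases j with
    | zero =>
      rw [chainTerm_succ_zero]
      exact ih hj (by omega)
    | succ j =>
      rw [chainTerm_succ_succ, map_add, map_add]
      exact add_nonneg (add_nonneg (ih hj (by omega)) (ih hj.le (by omega)))
        (ih (by omega) (by omega))

theorem chainTerm_succ_full_eq_zero (h : ChainNonneg x y z n k D)
    (hn : r + 1 + k + a + b + c = n) (h0 : D (chainTerm x y z (r + 1) k a b c) = 0) :
    D (chainTerm x y z r k (a + 1) b c) = 0 ∧ D (chainTerm x y z r k a (b + 1) c) = 0 ∧
      D (chainTerm x y z r k a b (c + 1)) = 0 := by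
  have hx := h.chainTerm_full_nonneg (r := r) (a := a + 1) (b := b) (c := c) (by omega)
  have hy := h.chainTerm_full_nonneg (r := r) (a := a) (b := b + 1) (c := c) (by omega)
  have hz := h.chainTerm_full_nonneg (r := r) (a := a) (b := b) (c := c + 1) (by omega)
  rwa [chainTerm_succ, map_add, map_add, add_eq_zero_iff_of_nonneg (add_nonneg hx hy) hz,
    add_eq_zero_iff_of_nonneg hx hy, and_assoc] at h0

theorem chainTerm_succ_balanced_eq_zero (h : ChainNonneg x y z n k D) (hj : j + 1 < k)
    (hn : r + 1 + (j + 1) + a + b + a = n)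
    (h0 : D (chainTerm x y z (r + 1) (j + 1) a b a) = 0) :
    D (chainTerm x y z r (j + 2) a b a) = 0 ∧ D (chainTerm x y z r (j + 1) a (b + 1) a) = 0 ∧
      D (chainTerm x y z r j (a + 1) b (a + 1)) = 0 := by
  have hlong := h.chainTerm_balanced_nonneg (r := r) (j := j + 2) (a := a) (b := b) (by omega)
    (by omega)
  have hone := h.chainTerm_balanced_nonneg (r := r) (j := j + 1) (a := a) (b := b + 1) (by omega)
    (by omega)
  have hpair := h.chainTerm_balanced_nonneg (r := r) (j := j) (a := a + 1) (b := b) (by omega)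
    (by omega)
  rwa [chainTerm_succ_succ, map_add, map_add, add_eq_zero_iff_of_nonneg (add_nonneg hlong hone)
    hpair, add_eq_zero_iff_of_nonneg hlong hone, and_assoc] at h0

theorem chainTerm_diagonal_eq_zero (h : ChainNonneg x y z n k D)
    (h0 : D (chainTerm x y z n 0 0 0 0) = 0) (hj : j ≤ k) (hn : r + j = n) :
    D (chainTerm x y z r j 0 0 0) = 0 := by
  induction j generalizing r with
  | zero => rwa [show r = n by omega]
  | succ j ih =>
    have hprev := ih (r := r + 1) (by omega) (by omega)
    cases j with
    | zero => rwa [chainTerm_succ_zero] at hprev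
    | succ j => exact (h.chainTerm_succ_balanced_eq_zero (by omega) (by omega) hprev).1

theorem chainTerm_full_eq_zero (h : ChainNonneg x y z n k D)
    (h0 : D (chainTerm x y z n 0 0 0 0) = 0) (hn : r + k + a + b + c = n) :
    D (chainTerm x y z r k a b c) = 0 := by
  induction a generalizing r with
  | succ a ih => exact (h.chainTerm_succ_full_eq_zero (by omega) (ih (by omega))).1
  | zero =>
    induction b generalizing r with
    | succ b ih => exact (h.chainTerm_succ_full_eq_zero (by omega) (ih (by omega))).2.1
    | zero =>
      induction c generalizing r with
      | succ c ih => exact (h.chainTerm_succ_full_eq_zero (by omega) (ih (by omega))).2.2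
      | zero => exact h.chainTerm_diagonal_eq_zero h0 le_rfl (by omega)

theorem chainTerm_single_eq_zero (h : ChainNonneg x y z n k D)
    (h0 : D (chainTerm x y z n 0 0 0 0) = 0) (hk : 2 ≤ k) (hn : r + 1 + b = n) :
    D (chainTerm x y z r 1 0 b 0) = 0 := by
  induction b generalizing r with
  | zero => exact h.chainTerm_diagonal_eq_zero h0 (by omega) (by omega)
  | succ b ih =>
    exact (h.chainTerm_succ_balanced_eq_zero (by omega) (by omega) (ih (by omega))).2.1

theorem chainTerm_point_eq_zero (h : ChainNonneg x y z n k D)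
    (h0 : D (chainTerm x y z n 0 0 0 0) = 0) (hk : 2 ≤ k) (hn : r + (a + 1) + b + (a + 1) = n) :
    D (chainTerm x y z r 0 (a + 1) b (a + 1)) = 0 := by
  induction a generalizing r with
  | zero =>
    have hsingle := h.chainTerm_single_eq_zero h0 hk (r := r + 1) (b := b) (by omega)
    exact (h.chainTerm_succ_balanced_eq_zero (by omega) (by omega) hsingle).2.2
  | succ a ih =>
    have hsingle := ih (r := r + 2) (by omega)
    rw [chainTerm_succ_zero] at hsingle
    exact (h.chainTerm_succ_balanced_eq_zero (by omega) (by omega) hsingle).2.2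

end ChainNonneg

end ChainPoly

section ChainWord

variable {j m s t a b c : ℕ}

/-- The word obtained from the zero word of length `j` after `s` steps, each adding `1` to the first
letter that is not yet `2`. -/
def raiseWord (j s : ℕ) : Fin j → Fin 3 := fun i => ⟨min 2 (s - 2 * i), by omega⟩

@[to_additive]
theorem prod_raiseWord {M : Type*} [CommMonoid M] (f : Fin 3 → M) (hs : s ≤ 2 * j) :
    ∏ i, f (raiseWord j s i) = f 0 ^ (j - (s + 1) / 2) * f 1 ^ (s % 2) * f 2 ^ (s / 2) := by
  induction j generalizing s with
  | zero =>
    obtain rfl : s = 0 := by omega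
    simp
  | succ j ih =>
    have tail (i : Fin j) : raiseWord (j + 1) s i.succ = raiseWord j (s - 2) i := by
      simp only [raiseWord, Fin.val_succ, Fin.mk.injEq]
      omega
    rw [Fin.prod_univ_succ, prod_congr rfl fun i _ => congrArg f (tail i), ih (by omega)]
    match s with
    | 0 => simp [raiseWord, pow_succ']
    | 1 => simp [raiseWord, mul_comm (f 1)]
    | s + 2 =>
      rw [show raiseWord (j + 1) (s + 2) 0 = 2 by simp [raiseWord],
        show j + 1 - (s + 2 + 1) / 2 = j - (s + 1) / 2 by omega,
        show (s + 2) / 2 = s / 2 + 1 by omega, Nat.add_mod_right, Nat.add_sub_cancel, pow_succ',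
        mul_left_comm]

theorem raiseWord_mono : Monotone (raiseWord j) := fun s t hst i => by
  rw [Fin.le_def]
  simp only [raiseWord]
  omega

/-- The word `0 ⋯ 0 1 ⋯ 1 2 ⋯ 2` with `a` zeros, `b` ones and `c` twos. -/
def blockWord (a b c : ℕ) : Fin (a + b + c) → Fin 3 :=
  Fin.append (Fin.append (fun _ => 0) fun _ => 1) fun _ => 2

@[to_additive]
theorem prod_blockWord {M : Type*} [CommMonoid M] (f : Fin 3 → M) :
    ∏ i, f (blockWord a b c i) = f 0 ^ a * f 1 ^ b * f 2 ^ c := by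
  simp [blockWord, Fin.prod_univ_add]

/-- The `s`-th word of the chain that raises `j` coordinates one after another from `0` to `2` and
keeps the remaining ones fixed at the letters of `v`. -/
def chainWord (j : ℕ) (v : Fin m → Fin 3) (s : ℕ) : Fin (j + m) → Fin 3 :=
  Fin.append (raiseWord j s) v

theorem chainWord_mono (v : Fin m → Fin 3) : Monotone (chainWord j v) := fun s t hst => by
  refine Fin.addCases (fun i => ?_) fun i => ?_
  · simpa only [chainWord, Fin.append_left] using raiseWord_mono hst i
  · simp only [chainWord, Fin.append_right, le_refl]

theorem coordSum_chainWord (v : Fin m → Fin 3) (hs : s ≤ 2 * j) :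
    coordSum (chainWord j v s) = s + coordSum v := by
  have hraise := sum_raiseWord (fun x => (x : ℕ)) hs
  simp only [coordSum, chainWord, Fin.sum_univ_add, Fin.append_left, Fin.append_right, hraise]
  simp only [Fin.coe_ofNat_eq_mod, Nat.zero_mod, smul_eq_mul]
  omega

theorem card_chainWord_lt_le (v : Fin m → Fin 3) (s t : ℕ) :
    #{i | chainWord j v s i < chainWord j v t i} ≤ j := by
  rw [card_filter, Fin.sum_univ_add]
  simp only [chainWord, Fin.append_left, Fin.append_right, lt_irrefl, if_false, sum_const_zero,
    add_zero]
  rw [← card_filter]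
  exact (card_le_univ _).trans_eq (Fintype.card_fin j)

theorem prod_chainWord_blockWord {M : Type*} [CommMonoid M] (f : Fin 3 → M) (hs : s ≤ 2 * j) :
    ∏ i, f (chainWord j (blockWord a b c) s i) =
      f 0 ^ (j - (s + 1) / 2) * f 1 ^ (s % 2) * f 2 ^ (s / 2) * (f 0 ^ a * f 1 ^ b * f 2 ^ c) := by
  simp only [chainWord, Fin.prod_univ_add, Fin.append_left, Fin.append_right, prod_raiseWord f hs,
    prod_blockWord f]

theorem coordSum_blockWord : coordSum (blockWord a b c) = b + 2 * c := by
  rw [coordSum, sum_blockWord fun x : Fin 3 => (x : ℕ)]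
  simp [mul_comm]

theorem coordSum_comp_perm {n : ℕ} (w : Fin n → Fin 3) (σ : Equiv.Perm (Fin n)) :
    coordSum (w ∘ σ) = coordSum w :=
  Equiv.sum_comp σ fun i => (w i : ℕ)

theorem Admissible.card_chainWord_comp_mem_le_one {k : ℕ} {A : Finset (Fin (j + m) → Fin 3)}
    (hA : Admissible k A) (hj : j ≤ k) (v : Fin m → Fin 3) (σ : Equiv.Perm (Fin (j + m))) :
    #{s ∈ range (2 * j + 1) | chainWord j v s ∘ σ ∈ A} ≤ 1 := by
  have not_lt {s t : ℕ} (ht : t ≤ 2 * j) (hsA : chainWord j v s ∘ σ ∈ A)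
      (htA : chainWord j v t ∘ σ ∈ A) : ¬ s < t := fun hst => by
    refine hA ⟨_, hsA, _, htA, fun heq => ?_, fun i => chainWord_mono v hst.le (σ i), ?_⟩
    · have := congrArg coordSum heq
      rw [coordSum_comp_perm, coordSum_comp_perm, coordSum_chainWord v (by omega),
        coordSum_chainWord v ht] at this
      omega
    · refine (card_equiv σ fun i => ?_).trans_le ((card_chainWord_lt_le v s t).trans hj)
      simp only [mem_filter, mem_univ, true_and, Function.comp_apply]
  refine card_le_one.2 fun s hs t ht => ?_
  simp only [mem_filter, mem_range, Nat.lt_succ_iff] at hs ht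
  exact le_antisymm (le_of_not_gt (not_lt hs.1 ht.2 hs.2)) (le_of_not_gt (not_lt ht.1 hs.2 ht.2))

end ChainWord

section ChainDensity

variable {n k j a b c s t : ℕ} {A : Finset (Fin n → Fin 3)}

/-- The proportion of words with `a` zeros, `b` ones and `c` twos that lie in `A`. It is only
meaningful when `a + b + c = n`. -/
noncomputable def typeDensity (A : Finset (Fin n → Fin 3)) (a b c : ℕ) : ℚ :=
  permDensity A (X 0 ^ a * X 1 ^ b * X 2 ^ c)

/-- The average number of elements of `A` on a chain that raises `j` coordinates from `0` to `2` and
fixes `a`, `b`, `c` coordinates at `0`, `1`, `2`. It is only meaningful when `j + a + b + c = n`. -/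
noncomputable def chainDensity (A : Finset (Fin n → Fin 3)) (j a b c : ℕ) : ℚ :=
  permDensity A (chainTerm (X 0) (X 1) (X 2) 0 j a b c)

theorem typeDensity_eq_permDensity_blockWord (A : Finset (Fin (a + b + c) → Fin 3)) :
    typeDensity A a b c = permDensity A (∏ i, X (blockWord a b c i)) := by
  rw [typeDensity, prod_blockWord]

theorem typeDensity_nonneg (A : Finset (Fin n → Fin 3)) (hn : a + b + c = n) :
    0 ≤ typeDensity A a b c := by
  subst hn
  rw [typeDensity_eq_permDensity_blockWord]
  exact permDensity_prod_X_nonneg A _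

theorem chainDensity_zero (A : Finset (Fin n → Fin 3)) :
    chainDensity A 0 a b c = typeDensity A a b c := by
  rw [chainDensity, chainTerm_zero_zero, typeDensity]

theorem chainDensity_eq_sum (A : Finset (Fin n → Fin 3)) (j a b c : ℕ) :
    chainDensity A j a b c =
      ∑ s ∈ range (2 * j + 1), typeDensity A (a + (j - (s + 1) / 2)) (b + s % 2) (c + s / 2) := by
  rw [chainDensity, chainTerm, chainPoly, pow_zero, one_mul, sum_mul, map_sum]
  refine sum_congr rfl fun s _ => congrArg _ ?_
  ring

theorem chainDensity_eq_expect (A : Finset (Fin (j + (a + b + c)) → Fin 3)) :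
    chainDensity A j a b c = 𝔼 σ : Equiv.Perm (Fin (j + (a + b + c))),
      (#{s ∈ range (2 * j + 1) | chainWord j (blockWord a b c) s ∘ σ ∈ A} : ℚ) := by
  rw [← sum_permDensity_prod_X, chainDensity, chainTerm, chainPoly, pow_zero, one_mul, sum_mul,
    map_sum]
  refine sum_congr rfl fun s hs => congrArg _ (prod_chainWord_blockWord X ?_).symm
  exact Nat.lt_succ_iff.1 (mem_range.1 hs)

theorem Admissible.chainDensity_le_one (hA : Admissible k A) (hj : j ≤ k)
    (hn : j + a + b + c = n) : chainDensity A j a b c ≤ 1 := by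
  obtain rfl : j + (a + b + c) = n := by omega
  rw [chainDensity_eq_expect]
  exact expect_le univ_nonempty fun σ _ =>
    mod_cast hA.card_chainWord_comp_mem_le_one hj (blockWord a b c) σ

theorem typeDensity_le_chainDensity (A : Finset (Fin n → Fin 3)) (hn : j + a + b + c = n)
    (hs : s ≤ 2 * j) :
    typeDensity A (a + (j - (s + 1) / 2)) (b + s % 2) (c + s / 2) ≤ chainDensity A j a b c := by
  rw [chainDensity_eq_sum]
  refine single_le_sum (f := fun s => typeDensity A (a + (j - (s + 1) / 2)) (b + s % 2) (c + s / 2))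
    (fun s hs => typeDensity_nonneg A ?_) (mem_range.2 (Nat.lt_succ_iff.2 hs))
  have := mem_range.1 hs
  omega

theorem Admissible.typeDensity_eq_zero (hA : Admissible k A) (hj : j ≤ k)
    (hn : j + a + b + c = n) (hs : s ≤ 2 * j) (ht : t ≤ 2 * j) (hst : s ≠ t)
    (h : typeDensity A (a + (j - (s + 1) / 2)) (b + s % 2) (c + s / 2) = 1) :
    typeDensity A (a + (j - (t + 1) / 2)) (b + t % 2) (c + t / 2) = 0 := by
  have nonneg (u : ℕ) (hu : u ∈ range (2 * j + 1)) :
      0 ≤ typeDensity A (a + (j - (u + 1) / 2)) (b + u % 2) (c + u / 2) :=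
    typeDensity_nonneg A (by have := mem_range.1 hu; omega)
  have ht' := mem_range.2 (Nat.lt_succ_iff.2 ht)
  have hle := hA.chainDensity_le_one hj hn
  have hpair := add_le_sum nonneg (mem_range.2 (Nat.lt_succ_iff.2 hs)) ht' hst
  rw [← chainDensity_eq_sum] at hpair
  linarith [nonneg t ht']

end ChainDensity

section MiddleLayers

variable {n k j a b c : ℕ} {A : Finset (Fin n → Fin 3)}

theorem mem_middleLayers {x : Fin n → Fin 3} :
    x ∈ middleLayers n k ↔ coordSum x ≡ n [MOD 2 * k + 1] := by
  simp only [middleLayers, mem_filter, mem_univ, true_and]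

theorem coordSum_le_add {x y : Fin n → Fin 3} (hxy : x ≤ y) :
    coordSum y ≤ coordSum x + 2 * #{i | x i < y i} := by
  rw [coordSum, coordSum, card_filter, mul_sum, ← sum_add_distrib]
  refine sum_le_sum fun i _ => ?_
  have := hxy i
  split_ifs <;> omega

theorem coordSum_strictMono : StrictMono (coordSum : (Fin n → Fin 3) → ℕ) := fun x y hxy => by
  obtain ⟨hle, i, hi⟩ := Pi.lt_def.1 hxy
  exact sum_lt_sum (fun i _ => hle i) ⟨i, mem_univ i, hi⟩

theorem admissible_middleLayers (n k : ℕ) : Admissible k (middleLayers n k) := by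
  rintro ⟨x, hx, y, hy, hne, hxy, hk⟩
  rw [mem_middleLayers] at hx hy
  have hlt := coordSum_strictMono (lt_of_le_of_ne hxy hne)
  have hdvd := (Nat.modEq_iff_dvd' hlt.le).1 (hx.trans hy.symm)
  have hle := Nat.le_of_dvd (by omega) hdvd
  have := coordSum_le_add hxy
  omega

theorem comp_perm_mem_middleLayers {w : Fin n → Fin 3} (hw : w ∈ middleLayers n k)
    (σ : Equiv.Perm (Fin n)) : w ∘ σ ∈ middleLayers n k := by
  rwa [mem_middleLayers, coordSum_comp_perm, ← mem_middleLayers]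

theorem chainDensity_middleLayers {s : ℕ} (hj : j ≤ k) (hn : j + a + b + c = n) (hs : s ≤ 2 * j)
    (h : s + b + 2 * c ≡ n [MOD 2 * k + 1]) : chainDensity (middleLayers n k) j a b c = 1 := by
  refine ((admissible_middleLayers n k).chainDensity_le_one hj hn).antisymm ?_
  refine le_of_eq_of_le ?_ (typeDensity_le_chainDensity _ hn hs)
  obtain rfl : a + (j - (s + 1) / 2) + (b + s % 2) + (c + s / 2) = n := by omega
  rw [typeDensity_eq_permDensity_blockWord, eq_comm, permDensity_prod_X_eq_one_iff]
  refine comp_perm_mem_middleLayers (mem_middleLayers.2 ?_)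
  rw [coordSum_blockWord]
  convert h using 1
  omega

theorem chainDensity_middleLayers_full (hn : k + a + b + c = n) :
    chainDensity (middleLayers n k) k a b c = 1 := by
  -- Modulo `2 * k + 1`, the factor `2 * k` is `-1`, so this `s` represents `n - (b + 2 * c)`.
  refine chainDensity_middleLayers (s := (n + 2 * k * (b + 2 * c)) % (2 * k + 1)) le_rfl hn
    (Nat.lt_succ_iff.1 (Nat.mod_lt _ (by omega))) ?_
  have hmul : n + 2 * k * (b + 2 * c) + b + 2 * c = n + (2 * k + 1) * (b + 2 * c) := by ring
  calc (n + 2 * k * (b + 2 * c)) % (2 * k + 1) + b + 2 * c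
      ≡ n + 2 * k * (b + 2 * c) + b + 2 * c [MOD 2 * k + 1] :=
        ((Nat.mod_modEq _ _).add_right b).add_right (2 * c)
    _ ≡ n [MOD 2 * k + 1] := by
        rw [hmul]
        exact Nat.add_modulus_mul_modEq_iff.2 rfl

theorem chainDensity_middleLayers_balanced (hj : j ≤ k) (hn : j + a + b + a = n) :
    chainDensity (middleLayers n k) j a b a = 1 :=
  chainDensity_middleLayers (s := j) hj hn (by omega) (by rw [show j + b + 2 * a = n by omega])

theorem Admissible.chainNonneg (hA : Admissible k A) :
    ChainNonneg (X 0) (X 1) (X 2) n k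
      (permDensity (middleLayers n k) - permDensity A).toAddMonoidHom where
  full _ _ _ hn := sub_nonneg.2 <|
    (hA.chainDensity_le_one le_rfl hn).trans_eq (chainDensity_middleLayers_full hn).symm
  balanced _ _ _ hj hn := sub_nonneg.2 <|
    (hA.chainDensity_le_one hj.le hn).trans_eq (chainDensity_middleLayers_balanced hj.le hn).symm

theorem permDensity_chainTerm_zero (A : Finset (Fin n → Fin 3)) :
    permDensity A (chainTerm (X 0) (X 1) (X 2) n 0 0 0 0) = #A := by
  rw [← permDensity_sum_X_pow, Fin.sum_univ_three, chainTerm, chainPoly_zero]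
  simp only [pow_zero, mul_one]

theorem Admissible.card_le (hA : Admissible k A) : #A ≤ #(middleLayers n k) := by
  have h := hA.chainNonneg.chainTerm_balanced_nonneg (r := n) (a := 0) (b := 0) k.zero_le rfl
  simpa [permDensity_chainTerm_zero] using h

end MiddleLayers

section Uniqueness

variable {n k a b c : ℕ} {A : Finset (Fin n → Fin 3)}

/-- The admissible set `A` meets, on average, exactly one word of each of the following chains:
those raising `k` coordinates, those raising one coordinate with all the others fixed at `1`, and
the one-word chains with as many letters `0` as letters `2`, at least one of each. Largest
admissible sets have this property, and it determines the densities of all types of words. -/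
structure ChainTight (k : ℕ) (A : Finset (Fin n → Fin 3)) : Prop where
  admissible : Admissible k A
  full : ∀ a b c, k + a + b + c = n → chainDensity A k a b c = 1
  single : ∀ b, 1 + b = n → chainDensity A 1 0 b 0 = 1
  point : ∀ a b, (a + 1) + b + (a + 1) = n → typeDensity A (a + 1) b (a + 1) = 1

theorem chainTight_middleLayers (hk : 1 ≤ k) : ChainTight k (middleLayers n k) where
  admissible := admissible_middleLayers n k
  full _ _ _ := chainDensity_middleLayers_full
  single _ hn := chainDensity_middleLayers_balanced hk (by omega)
  point _ _ hn := by
    rw [← chainDensity_zero, chainDensity_middleLayers_balanced k.zero_le (by omega)]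

theorem Admissible.chainTight (hA : Admissible k A) (hk : 2 ≤ k)
    (hcard : #A = #(middleLayers n k)) : ChainTight k A := by
  have h := hA.chainNonneg
  have h0 : (permDensity (middleLayers n k) - permDensity A).toAddMonoidHom
      (chainTerm (X 0) (X 1) (X 2) n 0 0 0 0) = 0 := by
    simp [permDensity_chainTerm_zero, hcard]
  have hB : ChainTight k (middleLayers n k) := chainTight_middleLayers (by omega)
  refine ⟨hA, fun a b c hn => ?_, fun b hn => ?_, fun a b hn => ?_⟩
  · rw [← hB.full a b c hn]
    exact (sub_eq_zero.1 (h.chainTerm_full_eq_zero h0 (r := 0) (by omega))).symm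
  · rw [← hB.single b hn]
    exact (sub_eq_zero.1 (h.chainTerm_single_eq_zero h0 hk (r := 0) (by omega))).symm
  · rw [← hB.point a b hn, ← chainDensity_zero, ← chainDensity_zero]
    exact (sub_eq_zero.1 (h.chainTerm_point_eq_zero h0 hk (r := 0) (by omega))).symm

namespace ChainTight

theorem typeDensity_balanced (h : ChainTight k A) (hk : 1 ≤ k) (hn : 2 ≤ n) (hab : a + b + a = n) :
    typeDensity A a b a = 1 := by
  cases a with
  | succ a => exact h.point a b hab
  | zero =>
    obtain ⟨b, rfl⟩ : ∃ b', b = b' + 2 := ⟨b - 2, by omega⟩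
    have hpoint : typeDensity A 1 b 1 = 1 := h.point 0 b (by omega)
    have hbottom : typeDensity A 1 (b + 1) 0 = 0 :=
      h.admissible.typeDensity_eq_zero (j := 1) (a := 1) (b := b) (c := 0) (s := 2) (t := 1) hk
        (by omega) (by omega) (by omega) (by omega) hpoint
    have htop : typeDensity A 0 (b + 1) 1 = 0 :=
      h.admissible.typeDensity_eq_zero (j := 1) (a := 0) (b := b) (c := 1) (s := 0) (t := 1) hk
        (by omega) (by omega) (by omega) (by omega) hpoint
    -- Only the middle one of the three types on this chain is left.
    have hsingle := h.single (b + 1) (by omega)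
    rw [chainDensity_eq_sum, sum_range_succ, sum_range_succ, sum_range_one] at hsingle
    simpa [hbottom, htop] using hsingle

-- A type that is not too unbalanced is the end of a chain through a balanced type.
theorem typeDensity_eq_zero (h : ChainTight k A) (hk : 1 ≤ k) (hn : 2 ≤ n)
    (habc : a + b + c = n) (hne : a ≠ c) (hac : a ≤ c + 2 * k) (hca : c ≤ a + 2 * k) :
    typeDensity A a b c = 0 := by
  rcases hne.lt_or_gt with hlt | hlt
  · obtain ⟨d, rfl⟩ := Nat.exists_eq_add_of_le hlt.le
    convert h.admissible.typeDensity_eq_zero (j := (d + 1) / 2) (a := a) (b := b)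
      (c := a + d - (d + 1) / 2) (s := 2 * ((d + 1) / 2) - d) (t := 2 * ((d + 1) / 2))
      (by omega) (by omega) (by omega) (by omega) (by omega) ?_ using 2
    any_goals omega
    convert h.typeDensity_balanced hk hn (a := a + d / 2) (b := b + d % 2) (by omega) using 2
    all_goals omega
  · obtain ⟨d, rfl⟩ := Nat.exists_eq_add_of_le hlt.le
    convert h.admissible.typeDensity_eq_zero (j := (d + 1) / 2) (a := c + d - (d + 1) / 2) (b := b)
      (c := c) (s := d) (t := 0)
      (by omega) (by omega) (by omega) (by omega) (by omega) ?_ using 2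
    any_goals omega
    convert h.typeDensity_balanced hk hn (a := c + d / 2) (b := b + d % 2) (by omega) using 2
    all_goals omega

theorem typeDensity_eq_of_chain {A' : Finset (Fin n → Fin 3)} {t : ℕ} (h : ChainTight k A)
    (h' : ChainTight k A') (hn : k + a + b + c = n) (ht : t ≤ 2 * k)
    (heq : ∀ s ≤ 2 * k, s ≠ t →
      typeDensity A (a + (k - (s + 1) / 2)) (b + s % 2) (c + s / 2) =
        typeDensity A' (a + (k - (s + 1) / 2)) (b + s % 2) (c + s / 2)) :
    typeDensity A (a + (k - (t + 1) / 2)) (b + t % 2) (c + t / 2) =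
      typeDensity A' (a + (k - (t + 1) / 2)) (b + t % 2) (c + t / 2) := by
  have hchain := (h.full a b c hn).trans (h'.full a b c hn).symm
  have ht' := mem_range.2 (Nat.lt_succ_iff.2 ht)
  rw [chainDensity_eq_sum, chainDensity_eq_sum, ← add_sum_erase _ _ ht', ← add_sum_erase _ _ ht',
    sum_congr rfl fun s hs => heq s (Nat.lt_succ_iff.1 (mem_range.1 (mem_of_mem_erase hs)))
      (ne_of_mem_erase hs)] at hchain
  exact add_right_cancel hchain

theorem typeDensity_eq {A' : Finset (Fin n → Fin 3)} (h : ChainTight k A) (h' : ChainTight k A')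
    (hk : 1 ≤ k) (hn : 2 ≤ n) (habc : a + b + c = n) :
    typeDensity A a b c = typeDensity A' a b c := by
  induction hd : Nat.dist a c using Nat.strong_induction_on generalizing a b c with
  | _ d ih =>
    unfold Nat.dist at hd ih
    rcases (show a = c ∨ (a ≠ c ∧ a ≤ c + 2 * k ∧ c ≤ a + 2 * k) ∨ a + 2 * k < c ∨ c + 2 * k < a
      by omega) with rfl | ⟨hne, hac, hca⟩ | hfar | hfar
    · rw [h.typeDensity_balanced hk hn habc, h'.typeDensity_balanced hk hn habc]
    · rw [h.typeDensity_eq_zero hk hn habc hne hac hca,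
        h'.typeDensity_eq_zero hk hn habc hne hac hca]
    -- A far type is an end of a chain whose other types are all closer to being balanced.
    · convert h.typeDensity_eq_of_chain h' (a := a) (b := b) (c := c - k) (t := 2 * k) (by omega)
        le_rfl fun s hs hst => ih _ (by omega) (by omega) rfl using 2 <;> omega
    · convert h.typeDensity_eq_of_chain h' (a := a - k) (b := b) (c := c) (t := 0) (by omega)
        (by omega) fun s hs hst => ih _ (by omega) (by omega) rfl using 2 <;> omega

end ChainTight

theorem exists_permDensity_prod_X_eq_typeDensity (w : Fin n → Fin 3) :
    ∃ a b c, a + b + c = n ∧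
      ∀ A : Finset (Fin n → Fin 3), permDensity A (∏ i, X (w i)) = typeDensity A a b c := by
  refine ⟨#{i | w i = 0}, #{i | w i = 1}, #{i | w i = 2}, ?_, fun A => ?_⟩
  · have hcard : #univ = ∑ v, #{i | w i = v} :=
      card_eq_sum_card_fiberwise fun i _ => mem_coe.2 (mem_univ (w i))
    rw [← Fin.sum_univ_three fun v => #{i | w i = v}, ← hcard, card_univ, Fintype.card_fin]
  · rw [typeDensity, ← Fintype.prod_fiberwise' w, Fin.prod_univ_three]
    simp only [prod_const, card_univ, Fintype.card_subtype]

theorem Admissible.eq_middleLayers (hA : Admissible k A) (hk : 2 ≤ k) (hn : 2 ≤ n)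
    (hcard : #A = #(middleLayers n k)) : A = middleLayers n k := by
  have hB : ChainTight k (middleLayers n k) := chainTight_middleLayers (by omega)
  refine (eq_of_subset_of_card_le (fun w hw => ?_) hcard.le).symm
  obtain ⟨a, b, c, habc, hw'⟩ := exists_permDensity_prod_X_eq_typeDensity w
  have hwB := permDensity_prod_X_eq_one_iff.2 (comp_perm_mem_middleLayers hw)
  rw [hw', ← (hA.chainTight hk hcard).typeDensity_eq hB (by omega) hn habc, ← hw'] at hwB
  exact permDensity_prod_X_eq_one_iff.1 hwB 1

end Uniqueness

theorem middleLayers_zero (n : ℕ) : middleLayers n 0 = univ := by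
  simp [middleLayers, Nat.modEq_one]

theorem theorem1 (n k : ℕ) (hk : k ≤ n) :
    Admissible k (middleLayers n k) ∧
    (∀ A : Finset (Fin n → Fin 3), Admissible k A → A.card ≤ (middleLayers n k).card) ∧
    (k ≠ 1 → ∀ A : Finset (Fin n → Fin 3), Admissible k A →
      A.card = (middleLayers n k).card → A = middleLayers n k) := by
  refine ⟨admissible_middleLayers n k, fun A hA => hA.card_le, fun hk1 A hA hcard => ?_⟩
  rcases (show k = 0 ∨ 2 ≤ k by omega) with rfl | hk2
  · rw [middleLayers_zero] at hcard ⊢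
    exact (card_eq_iff_eq_univ A).1 hcard
  · exact hA.eq_middleLayers hk2 (hk2.trans hk) hcard
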